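/- For a permutation $\sigma$ of $[n]=\{1,\dots,n\}$ let $\mathrm{fp}(\sigma)$ be its number of fixed points ($\sigma(i)=i$), $\mathrm{exc}(\sigma)$ its number of excedances ($\sigma(i)>i$), $\ell(\sigma)$ the length of its longest increasing subsequence, and let the rank $\mathrm{rk}(\sigma)$ be the largest $k\in\{0,\dots,n\}$ such that $\sigma(i)>k$ for all $i\le k$. For a pattern $\pi\in S_3$, call $\sigma$ $\pi$-avoiding if there are no indices $i_1<i_2<i_3$ such that $(\sigma(i_1),\sigma(i_2),\sigma(i_3))$ is in the same relative order as $(\pi(1),\pi(2),\pi(3))$. Theorem. For all integers $n,i,j,k\ge 0$, the number of $321$-avoiding permutations $\sigma\in S_n$ with $\mathrm{fp}(\sigma)=i$, $\mathrm{exc}(\sigma)=j$ and $\ell(\sigma)=k$ equals the number of $132$-avoiding permutations $\sigma\in S_n$ with $\mathrm{fp}(\sigma)=i$, $\mathrm{exc}(\sigma)=j$ and $\mathrm{rk}(\sigma)=n-k$. -/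

import Mathlib

/-! Permutations of `[n] = {1, …, n}` are modelled as `Equiv.Perm (Fin n)`: the index `i : Fin n`
stands for the integer `i + 1`, and the value `σ i` stands for the integer `σ i + 1`. -/

namespace PatternAvoidance

/-- `σ` contains `π`: there are positions `i₁ < ⋯ < iₘ` at which the values of `σ` are in the same
relative order as the values of `π`. -/
def Contains {m n : ℕ} (σ : Equiv.Perm (Fin n)) (π : Equiv.Perm (Fin m)) : Prop :=
  ∃ f : Fin m → Fin n, (∀ a b, a < b → f a < f b) ∧ ∀ a b, σ (f a) < σ (f b) ↔ π a < π b

/-- `σ` is `π`-avoiding. -/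
def Avoids {m n : ℕ} (σ : Equiv.Perm (Fin n)) (π : Equiv.Perm (Fin m)) : Prop :=
  ¬ Contains σ π

/-- The pattern `321`. -/
def pattern321 : Equiv.Perm (Fin 3) := Equiv.swap 0 2

/-- The pattern `132`. -/
def pattern132 : Equiv.Perm (Fin 3) := Equiv.swap 1 2

/-- The number of fixed points of `σ`. -/
def fp {n : ℕ} (σ : Equiv.Perm (Fin n)) : ℕ :=
  (Finset.univ.filter fun i : Fin n => σ i = i).card

/-- The number of excedances of `σ`, i.e. of `i` with `σ i > i`. -/
def exc {n : ℕ} (σ : Equiv.Perm (Fin n)) : ℕ :=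
  (Finset.univ.filter fun i : Fin n => σ i > i).card

/-- The length of a longest increasing subsequence of `σ`: the largest size of a set of positions
on which `σ` is increasing. -/
def lis {n : ℕ} (σ : Equiv.Perm (Fin n)) : ℕ :=
  (Finset.univ.filter fun s : Finset (Fin n) => ∀ a ∈ s, ∀ b ∈ s, a < b → σ a < σ b).sup
    Finset.card

/-- The rank of `σ`: the largest `k ∈ {0, …, n}` such that `σ(i) > k` for all `i ≤ k`
(with positions and values counted from `1`, hence the `+ 1`). -/
def rank {n : ℕ} (σ : Equiv.Perm (Fin n)) : ℕ :=
  Nat.findGreatest (fun k => ∀ i : Fin n, (i : ℕ) + 1 ≤ k → (σ i : ℕ) + 1 > k) n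

end PatternAvoidance

/-!
Both families of permutations are encoded by the same combinatorial objects, pairs of ballot paths
of length `n` with the same final height, and the statistics are read off from the pair in the same
way on both sides. A path is recorded by the function that counts its down steps. The relevant data
of a pair are:

* the number `r` of down steps of either path;
* among the times `t < n` at which the lower of the two heights is smaller than at all later times
  (`IsFutureMin`), the number of those where the paths have the same height (`numTies`) and the
  number of those where the second path is strictly lower (`numSecondLower`).

In both families there are `numTies` fixed points and `r + numSecondLower` excedances, while `r` is
`n` minus the length of a longest increasing subsequence in the first family and the rank in the
second.

For a 321-avoiding `σ` the paths rise when the longest increasing subsequence of a prefix of `σ`,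
or of `σ⁻¹`, gets longer; their down steps are the second rows of the Robinson–Schensted tableaux.
Let `c t` be the number of excedances crossing the diagonal at `t`. An entry of a 321-avoiding
permutation is a left-to-right maximum or a right-to-left minimum, and this shows how the two
prefix lengths `p`, `q` move with `t`. Always `|p - q| ≤ c`. An excedance position makes `p` grow,
and a weak anti-excedance value makes `q` grow. A weak anti-excedance position makes `p` grow
exactly if `q - p = c`, and an excedance value makes `q` grow exactly if `p - q = c`. So
`p + q - t - c` is a floor under both paths that rises by one exactly when one of the latter two growths
happens, and then a path touches it (`Avoids.floorHeight_succ`). Its rises are therefore the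
strict future minima, the ties being the fixed points. The paths determine the floor, hence `c`,
hence the positions and values of the excedances, hence `σ`.

For a 132-avoiding `σ` the paths are the two halves, each read from its outer end, of the Dyck
path bounding the diagram of `σ`, in which the down step of position `w` closes the up step of
value `σ w` (`Avoids.add_runMin_inv`). The entries with `w` and `σ w` at least the rank `r` join
the two halves, and each contributes a strict future minimum, whose type is the sign of `σ w - w`
(`Avoids.isFutureMin_of_isOuter`). There are `n - 2 * r` such entries and at most as many strict
future minima, so this is a bijection. Every pair of paths occurs: the lexicographically smallest
permutation above the corresponding lower bound avoids 132 (`exists_avoids_132_of_paths`).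

This gives an injection of the 321-avoiding into the 132-avoiding permutations that respects the
statistics. It is a bijection because the Simion–Schmidt argument, which keeps the running minima,
gives an injection in the other direction (`ncard_avoids_132_le`).
-/

namespace PatternAvoidance

open Finset

variable {n : ℕ}

/-! ### Patterns of length three -/

lemma avoids_pattern321_iff (σ : Equiv.Perm (Fin n)) :
    Avoids σ pattern321 ↔ ∀ i j k, i < j → j < k → σ j < σ i → ¬ σ k < σ j := by
  constructor
  · intro h i j k hij hjk h1 h2
    refine h ⟨![i, j, k], ?_, ?_⟩
    · intro a b
      fin_cases a <;> fin_cases b <;> simp [hij, hjk, hij.trans hjk]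
    · intro a b
      fin_cases a <;> fin_cases b <;>
        simp [pattern321, Equiv.swap_apply_def, h1, h2, h1.le, h2.le, h2.trans h1, (h2.trans h1).le]
  · rintro h ⟨f, hf, hσ⟩
    exact h (f 0) (f 1) (f 2) (hf _ _ (by decide)) (hf _ _ (by decide))
      ((hσ _ _).2 (by decide)) ((hσ _ _).2 (by decide))

lemma avoids_pattern132_iff (σ : Equiv.Perm (Fin n)) :
    Avoids σ pattern132 ↔ ∀ i j k, i < j → j < k → σ i < σ k → ¬ σ k < σ j := by
  constructor
  · intro h i j k hij hjk h1 h2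
    refine h ⟨![i, j, k], ?_, ?_⟩
    · intro a b
      fin_cases a <;> fin_cases b <;> simp [hij, hjk, hij.trans hjk]
    · intro a b
      fin_cases a <;> fin_cases b <;>
        simp [pattern132, Equiv.swap_apply_def, h1, h2, h1.le, h2.le, h1.trans h2, (h1.trans h2).le]
  · rintro h ⟨f, hf, hσ⟩
    exact h (f 0) (f 1) (f 2) (hf _ _ (by decide)) (hf _ _ (by decide))
      ((hσ _ _).2 (by decide)) ((hσ _ _).2 (by decide))

lemma Avoids.inv_321 {σ : Equiv.Perm (Fin n)} (h : Avoids σ pattern321) :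
    Avoids σ⁻¹ pattern321 := by
  rw [avoids_pattern321_iff] at h ⊢
  intro i j k hij hjk h1 h2
  exact h _ _ _ h2 h1 (by simpa using hjk) (by simpa using hij)

lemma Avoids.inv_132 {σ : Equiv.Perm (Fin n)} (h : Avoids σ pattern132) :
    Avoids σ⁻¹ pattern132 := by
  rw [avoids_pattern132_iff] at h ⊢
  intro i j k hij hjk h1 h2
  exact h _ _ _ h1 h2 (by simpa using hij) (by simpa using hjk)

lemma perm_inv_apply (σ : Equiv.Perm (Fin n)) (i : Fin n) : σ⁻¹ (σ i) = i :=
  σ.symm_apply_apply i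

lemma perm_apply_inv (σ : Equiv.Perm (Fin n)) (i : Fin n) : σ (σ⁻¹ i) = i :=
  σ.apply_symm_apply i

/-! ### Weak excedances of 321-avoiding permutations -/

/-- A weak anti-excedance of a 321-avoiding permutation is a right-to-left minimum: otherwise all
values at positions `< i`, together with a smaller value at a later position, are among the
`σ i ≤ i` values below `σ i`. -/
lemma Avoids.lt_of_apply_le {σ : Equiv.Perm (Fin n)} (h : Avoids σ pattern321) {i j : Fin n}
    (hi : σ i ≤ i) (hij : i < j) : σ i < σ j := by
  rw [avoids_pattern321_iff] at h
  by_contra hlt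
  have hji : σ j < σ i := lt_of_le_of_ne (not_lt.1 hlt) fun e => hij.ne' (σ.injective e)
  have hall : ∀ k < i, σ k < σ i := fun k hk => by
    by_contra hc
    exact h k i j hk hij (lt_of_le_of_ne (not_lt.1 hc) fun e => hk.ne' (σ.injective e)) hji
  have hsub : (insert j (Finset.Iio i)).image σ ⊆ Finset.Iio (σ i) := by
    intro v hv
    simp only [mem_image, mem_insert, mem_Iio] at hv ⊢
    rcases hv with ⟨k, rfl | hk, rfl⟩
    · exact hji
    · exact hall k hk
  have hcard := card_le_card hsub
  rw [card_image_of_injective _ σ.injective, card_insert_of_notMem (by simp [hij.le]),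
    Fin.card_Iio, Fin.card_Iio] at hcard
  have : (σ i).val ≤ i.val := hi
  omega

/-- A weak excedance of a 321-avoiding permutation is a left-to-right maximum. -/
lemma Avoids.lt_of_le_apply {σ : Equiv.Perm (Fin n)} (h : Avoids σ pattern321) {i j : Fin n}
    (hj : j ≤ σ j) (hij : i < j) : σ i < σ j := by
  by_contra hlt
  have hji : σ j < σ i := lt_of_le_of_ne (not_lt.1 hlt) fun e => hij.ne' (σ.injective e)
  have := h.inv_321.lt_of_apply_le (i := σ j) (by simpa using hj) hji
  rw [perm_inv_apply, perm_inv_apply] at this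
  exact lt_asymm this hij

/-! ### Longest increasing subsequences within a set of positions -/

/-- `σ` is increasing on the set `s` of positions. -/
def IncOn (σ : Equiv.Perm (Fin n)) (s : Finset (Fin n)) : Prop :=
  ∀ a ∈ s, ∀ b ∈ s, a < b → σ a < σ b

open scoped Classical in
/-- The length of a longest increasing subsequence of `σ` among the first `t` positions. -/
noncomputable def prefixLis (σ : Equiv.Perm (Fin n)) (t : ℕ) : ℕ :=
  (Finset.univ.filter fun s : Finset (Fin n) => (∀ i ∈ s, i.val < t) ∧ IncOn σ s).sup Finset.card

/-- The number of excedances of `σ` that cross the diagonal at `t`, i.e. of positions `i < t` with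
value at least `t`. -/
def crossing (σ : Equiv.Perm (Fin n)) (t : ℕ) : ℕ := #{i : Fin n | i.val < t ∧ t ≤ (σ i).val}

lemma IncOn.card_le_prefixLis {σ : Equiv.Perm (Fin n)} {s : Finset (Fin n)} {t : ℕ}
    (hs : IncOn σ s) (ht : ∀ i ∈ s, i.val < t) : #s ≤ prefixLis σ t := by
  classical exact Finset.le_sup (f := Finset.card) (mem_filter.2 ⟨mem_univ s, ht, hs⟩)

lemma exists_card_eq_prefixLis (σ : Equiv.Perm (Fin n)) (t : ℕ) :
    ∃ s : Finset (Fin n), (∀ i ∈ s, i.val < t) ∧ IncOn σ s ∧ #s = prefixLis σ t := by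
  classical
  obtain ⟨s, hs, he⟩ := Finset.exists_mem_eq_sup
    (Finset.univ.filter fun s : Finset (Fin n) => (∀ i ∈ s, i.val < t) ∧ IncOn σ s)
    ⟨∅, by simp only [mem_filter]; simp [IncOn]⟩ Finset.card
  simp only [mem_filter, mem_univ, true_and] at hs
  exact ⟨s, hs.1, hs.2, by rw [← he, prefixLis]⟩

lemma prefixLis_self (σ : Equiv.Perm (Fin n)) : prefixLis σ n = lis σ := by
  unfold prefixLis lis IncOn
  congr 1
  ext s
  simp

lemma prefixLis_zero (σ : Equiv.Perm (Fin n)) : prefixLis σ 0 = 0 := by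
  obtain ⟨s, hs, -, hc⟩ := exists_card_eq_prefixLis σ 0
  rw [← hc, card_eq_zero, eq_empty_iff_forall_notMem]
  exact fun i hi => by simpa using hs i hi

lemma prefixLis_le (σ : Equiv.Perm (Fin n)) (t : ℕ) : prefixLis σ t ≤ t := by
  obtain ⟨s, hs, -, hc⟩ := exists_card_eq_prefixLis σ t
  rw [← hc, ← Finset.card_range t, ← card_map Fin.valEmbedding]
  apply card_le_card
  intro i hi
  simp only [mem_map, Fin.valEmbedding_apply] at hi
  obtain ⟨a, ha, rfl⟩ := hi
  simpa using hs a ha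

lemma prefixLis_mono (σ : Equiv.Perm (Fin n)) : Monotone (prefixLis σ) := by
  intro t u htu
  obtain ⟨s, hs, hI, hc⟩ := exists_card_eq_prefixLis σ t
  exact hc ▸ hI.card_le_prefixLis fun i hi => (hs i hi).trans_le htu

lemma IncOn.mono {σ : Equiv.Perm (Fin n)} {s t : Finset (Fin n)} (h : IncOn σ t) (hst : s ⊆ t) :
    IncOn σ s := fun a ha b hb => h a (hst ha) b (hst hb)

lemma prefixLis_succ_le (σ : Equiv.Perm (Fin n)) (t : ℕ) :
    prefixLis σ (t + 1) ≤ prefixLis σ t + 1 := by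
  obtain ⟨s, hs, hI, hc⟩ := exists_card_eq_prefixLis σ (t + 1)
  have h1 : #(s.filter fun i => i.val < t) ≤ prefixLis σ t :=
    (hI.mono (filter_subset _ _)).card_le_prefixLis fun i hi => (mem_filter.1 hi).2
  have h2 : #(s.filter fun i => ¬ i.val < t) ≤ 1 := by
    refine card_le_one.2 fun a ha b hb => Fin.ext ?_
    have ha' := mem_filter.1 ha
    have hb' := mem_filter.1 hb
    have := hs a ha'.1
    have := hs b hb'.1
    omega
  have := card_filter_add_card_filter_not (s := s) (fun i => i.val < t)
  omega

lemma IncOn.map_inv {σ : Equiv.Perm (Fin n)} {s : Finset (Fin n)} (h : IncOn σ s) :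
    IncOn σ⁻¹ (s.map σ.toEmbedding) := by
  intro a ha b hb hab
  simp only [mem_map, Equiv.coe_toEmbedding] at ha hb
  obtain ⟨a, ha, rfl⟩ := ha
  obtain ⟨b, hb, rfl⟩ := hb
  rw [perm_inv_apply, perm_inv_apply]
  by_contra hc
  rcases lt_or_eq_of_le (not_lt.1 hc) with hlt | rfl
  · exact lt_asymm hab (h b hb a ha hlt)
  · exact lt_irrefl _ hab

/-- As many values below `t` sit at positions `≥ t` as positions below `t` carry values `≥ t`. -/
lemma crossing_inv (σ : Equiv.Perm (Fin n)) (t : ℕ) : crossing σ⁻¹ t = crossing σ t := by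
  have h1 : crossing σ⁻¹ t = #{i : Fin n | (σ i).val < t ∧ t ≤ i.val} := by
    unfold crossing
    rw [← card_map σ⁻¹.toEmbedding]
    congr 1
    ext i
    simp only [mem_map_equiv, mem_filter, mem_univ, true_and]
    simp [Equiv.Perm.inv_def]
  have h2 : #{i : Fin n | (σ i).val < t} = #{i : Fin n | i.val < t} := by
    rw [← card_map σ.toEmbedding]
    congr 1
    ext i
    simp only [mem_map_equiv, mem_filter, mem_univ, true_and]
    simp
  have h3 := card_filter_add_card_filter_not (s := ({i : Fin n | (σ i).val < t} : Finset _))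
    (fun i => i.val < t)
  have h4 := card_filter_add_card_filter_not (s := ({i : Fin n | i.val < t} : Finset _))
    (fun i => (σ i).val < t)
  simp only [filter_filter, not_lt] at h3 h4
  have h5 : #{i : Fin n | (σ i).val < t ∧ i.val < t} =
      #{i : Fin n | i.val < t ∧ (σ i).val < t} := by
    simp only [and_comm]
  rw [h1]
  unfold crossing
  omega

lemma crossing_zero (σ : Equiv.Perm (Fin n)) : crossing σ 0 = 0 := by simp [crossing]

lemma crossing_self (σ : Equiv.Perm (Fin n)) : crossing σ n = 0 := by
  simp [crossing]

lemma crossing_pos {σ : Equiv.Perm (Fin n)} {t : ℕ} {i : Fin n} (h1 : i.val < t)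
    (h2 : t ≤ (σ i).val) : 0 < crossing σ t :=
  card_pos.2 ⟨i, by simp [h1, h2]⟩

lemma crossing_succ (σ : Equiv.Perm (Fin n)) (t : Fin n) :
    crossing σ (t + 1) + (if σ⁻¹ t < t then 1 else 0) =
      crossing σ t + (if t < σ t then 1 else 0) := by
  have hA : crossing σ (t + 1) =
      #{i : Fin n | i.val < t.val ∧ t.val + 1 ≤ (σ i).val} + (if t < σ t then 1 else 0) := by
    have : ({i : Fin n | i.val < t.val + 1 ∧ t.val + 1 ≤ (σ i).val} : Finset (Fin n)) =
        ({i : Fin n | i.val < t.val ∧ t.val + 1 ≤ (σ i).val} : Finset (Fin n)) ∪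
          (if t < σ t then {t} else ∅) := by
      ext i
      split_ifs with h
      · simp only [mem_filter, mem_univ, true_and, mem_union, mem_singleton, Fin.ext_iff]
        rw [Fin.lt_def] at h
        constructor
        · rintro ⟨h1, h2⟩; omega
        · rintro (⟨h1, h2⟩ | h1)
          · omega
          · obtain rfl := Fin.ext h1; omega
      · simp only [mem_filter, mem_univ, true_and, union_empty]
        rw [Fin.lt_def] at h
        constructor
        · rintro ⟨h1, h2⟩
          refine ⟨lt_of_le_of_ne (by omega) fun e => ?_, h2⟩
          obtain rfl := Fin.ext e; omega
        · rintro ⟨h1, h2⟩; omega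
    rw [crossing, this, card_union_of_disjoint]
    · split_ifs <;> simp
    · split_ifs <;> simp
  have hB : crossing σ t =
      #{i : Fin n | i.val < t.val ∧ t.val + 1 ≤ (σ i).val} + (if σ⁻¹ t < t then 1 else 0) := by
    have : ({i : Fin n | i.val < t.val ∧ t.val ≤ (σ i).val} : Finset (Fin n)) =
        ({i : Fin n | i.val < t.val ∧ t.val + 1 ≤ (σ i).val} : Finset (Fin n)) ∪
          (if σ⁻¹ t < t then {σ⁻¹ t} else ∅) := by
      ext i
      have key : σ i = t ↔ i = σ⁻¹ t := by rw [Equiv.Perm.eq_inv_iff_eq]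
      have key' : (σ i).val = t.val ↔ i = σ⁻¹ t := by rw [← key, Fin.ext_iff]
      split_ifs with h
      · simp only [mem_filter, mem_univ, true_and, mem_union, mem_singleton, ← key']
        constructor
        · rintro ⟨h1, h2⟩; omega
        · rintro (⟨h1, h2⟩ | h1)
          · omega
          · have := key'.1 h1
            subst this
            exact ⟨h, by omega⟩
      · simp only [mem_filter, mem_univ, true_and, union_empty]
        constructor
        · rintro ⟨h1, h2⟩
          refine ⟨h1, lt_of_le_of_ne h2 fun e => h ?_⟩
          rw [← key'.1 e.symm]; exact h1
        · rintro ⟨h1, h2⟩; omega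
    rw [crossing, this, card_union_of_disjoint]
    · split_ifs <;> simp
    · split_ifs <;> simp
  omega

/-- Deleting the entries that cross the diagonal at `t` from a sequence with values below `t` leaves
a sequence with positions below `t`. -/
lemma prefixLis_inv_le (σ : Equiv.Perm (Fin n)) (t : ℕ) :
    prefixLis σ⁻¹ t ≤ prefixLis σ t + crossing σ t := by
  obtain ⟨s, hs, hI, hc⟩ := exists_card_eq_prefixLis σ⁻¹ t
  have h1 : #(s.filter fun v => (σ⁻¹ v).val < t) ≤ prefixLis σ t := by
    have := (hI.mono (filter_subset (fun v => (σ⁻¹ v).val < t) s)).map_inv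
    rw [inv_inv] at this
    rw [← card_map σ⁻¹.toEmbedding]
    refine this.card_le_prefixLis fun i hi => ?_
    simp only [mem_map, mem_filter, Equiv.coe_toEmbedding] at hi
    obtain ⟨v, hv, rfl⟩ := hi
    exact hv.2
  have h2 : #(s.filter fun v => ¬ (σ⁻¹ v).val < t) ≤ crossing σ t := by
    rw [← crossing_inv]
    refine card_le_card fun v hv => ?_
    simp only [mem_filter, mem_univ, true_and, not_lt] at hv ⊢
    exact ⟨hs v hv.1, hv.2⟩
  have := card_filter_add_card_filter_not (s := s) (fun v => (σ⁻¹ v).val < t)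
  omega

lemma Avoids.prefixLis_succ {σ : Equiv.Perm (Fin n)} (h : Avoids σ pattern321) {t : Fin n}
    (ht : t ≤ σ t) : prefixLis σ (t + 1) = prefixLis σ t + 1 := by
  refine le_antisymm (prefixLis_succ_le σ t) ?_
  obtain ⟨s, hs, hI, hc⟩ := exists_card_eq_prefixLis σ t
  have hts : t ∉ s := fun hh => lt_irrefl _ (hs t hh)
  rw [← hc, ← card_insert_of_notMem hts]
  refine IncOn.card_le_prefixLis ?_ ?_
  · intro a ha b hb hab
    rw [mem_insert] at ha hb
    rcases hb with rfl | hb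
    · exact h.lt_of_le_apply ht hab
    · rcases ha with rfl | ha
      · exact absurd hab (not_lt.2 (le_of_lt (hs b hb)))
      · exact hI a ha b hb hab
  · intro i hi
    rcases mem_insert.1 hi with rfl | hi
    · omega
    · exact (hs i hi).trans (Nat.lt_succ_self _)

/-- If an anti-excedance at position `t` lengthens the longest increasing subsequence of the
prefix, then the longer sequence has values below `t`, and the anti-excedances that cross the
diagonal at `t` can be appended to it. -/
lemma Avoids.prefixLis_add_crossing_le {σ : Equiv.Perm (Fin n)} (h : Avoids σ pattern321)
    {t : Fin n} (ht : σ t < t) (hrise : prefixLis σ (t + 1) = prefixLis σ t + 1) :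
    prefixLis σ t + crossing σ t ≤ prefixLis σ⁻¹ t := by
  obtain ⟨s, hs, hI, hc⟩ := exists_card_eq_prefixLis σ (t + 1)
  have hlt : ∀ i ∈ s.erase t, i < t := fun i hi => by
    have := hs i (mem_of_mem_erase hi)
    have hne : i.val ≠ t.val := fun e => (mem_erase.1 hi).1 (Fin.ext e)
    rw [Fin.lt_def]; omega
  have hts : t ∈ s := by
    by_contra hts
    have := hI.card_le_prefixLis (t := t) fun i hi => hlt i (by rwa [erase_eq_of_notMem hts])
    omega
  set d : Finset (Fin n) := {i : Fin n | (σ i).val < t ∧ t ≤ i} with hd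
  have hdisj : Disjoint (s.erase t) d := by
    rw [disjoint_left]
    intro i hi hi'
    simp only [hd, mem_filter] at hi'
    exact not_le.2 (hlt i hi) hi'.2.2
  have hdc : #d = crossing σ t := by
    rw [← crossing_inv, crossing, ← card_map σ.toEmbedding]
    congr 1
    ext v
    simp only [mem_map_equiv, hd, mem_filter, mem_univ, true_and, Fin.le_def]
    simp [Equiv.Perm.inv_def]
  have hcard : #(s.erase t ∪ d) = prefixLis σ t + crossing σ t := by
    rw [card_union_of_disjoint hdisj, hdc, card_erase_of_mem hts]; omega
  rw [← hcard, ← card_map σ.toEmbedding]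
  refine IncOn.card_le_prefixLis (IncOn.map_inv ?_) ?_
  · intro a ha b hb hab
    rw [mem_union] at ha hb
    rcases ha with ha | ha
    · have hat : σ a < σ t := hI a (mem_of_mem_erase ha) t hts (hlt a ha)
      rcases hb with hb | hb
      · exact hI a (mem_of_mem_erase ha) b (mem_of_mem_erase hb) hab
      · simp only [hd, mem_filter, mem_univ, true_and] at hb
        rcases eq_or_lt_of_le hb.2 with rfl | hb'
        · exact hat
        · exact hat.trans (h.lt_of_apply_le ht.le hb')
    · simp only [hd, mem_filter, mem_univ, true_and] at ha
      exact h.lt_of_apply_le (le_of_lt (lt_of_lt_of_le ha.1 ha.2)) hab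
  · intro v hv
    simp only [mem_map, Equiv.coe_toEmbedding] at hv
    obtain ⟨i, hi, rfl⟩ := hv
    rcases mem_union.1 hi with hi | hi
    · exact (hI i (mem_of_mem_erase hi) t hts (hlt i hi)).trans ht
    · simp only [hd, mem_filter, mem_univ, true_and] at hi
      exact hi.1

/-! ### Strict future minima of a pair of lattice paths -/

/-- The functions `x` and `y` count the down steps among the first `t` steps of two lattice paths
with up and down steps, whose heights after `t` steps are `t - 2 * x t` and `t - 2 * y t`. The time
`t` is a strict future minimum if the lower of the two heights is, at every later time `s ≤ n`,
larger than it is at time `t`. The inequality is stated without subtraction. -/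
def IsFutureMin (x y : ℕ → ℕ) (n t : ℕ) : Prop :=
  ∀ s, t < s → s ≤ n → t + 2 * max (x s) (y s) < s + 2 * max (x t) (y t)

open scoped Classical in
/-- The number of strict future minima at which both paths have the same height. -/
noncomputable def numTies (x y : ℕ → ℕ) (n : ℕ) : ℕ :=
  #{t ∈ range n | IsFutureMin x y n t ∧ x t = y t}

open scoped Classical in
/-- The number of strict future minima at which the second path is strictly lower. -/
noncomputable def numSecondLower (x y : ℕ → ℕ) (n : ℕ) : ℕ :=
  #{t ∈ range n | IsFutureMin x y n t ∧ x t < y t}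

lemma IsFutureMin.congr {x y x' y' : ℕ → ℕ} {t : ℕ} (hx : ∀ s ≤ n, x s = x' s)
    (hy : ∀ s ≤ n, y s = y' s) (ht : t ≤ n) : IsFutureMin x y n t ↔ IsFutureMin x' y' n t := by
  unfold IsFutureMin
  refine forall₃_congr fun s _ hs => ?_
  rw [hx s hs, hy s hs, hx t ht, hy t ht]

lemma IsFutureMin.swap {x y : ℕ → ℕ} {t : ℕ} (h : IsFutureMin x y n t) : IsFutureMin y x n t := by
  intro s hs hn
  rw [max_comm (y s), max_comm (y t)]
  exact h s hs hn

/-! ### The two paths of a 321-avoiding permutation -/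

/-- The number of `s ≤ t` at which the longest increasing subsequence of the first `s` positions is
no longer than that of the first `s - 1` positions. -/
noncomputable def lisDefect (σ : Equiv.Perm (Fin n)) (t : ℕ) : ℕ := t - prefixLis σ t

/-- The height of the floor under the two paths of a 321-avoiding permutation. -/
noncomputable def floorHeight (σ : Equiv.Perm (Fin n)) (t : ℕ) : ℤ :=
  prefixLis σ t + prefixLis σ⁻¹ t - t - crossing σ t

lemma prefixLis_le_inv (σ : Equiv.Perm (Fin n)) (t : ℕ) :
    prefixLis σ t ≤ prefixLis σ⁻¹ t + crossing σ t := by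
  simpa [crossing_inv] using prefixLis_inv_le σ⁻¹ t

lemma prefixLis_inv_self (σ : Equiv.Perm (Fin n)) : prefixLis σ⁻¹ n = lis σ := by
  have h1 := prefixLis_le_inv σ n
  have h2 := prefixLis_inv_le σ n
  rw [crossing_self] at h1 h2
  rw [← prefixLis_self]
  omega

lemma floorHeight_self (σ : Equiv.Perm (Fin n)) : floorHeight σ n = 2 * lis σ - n := by
  rw [floorHeight, prefixLis_self, prefixLis_inv_self, crossing_self]
  push_cast
  ring

lemma floorHeight_zero (σ : Equiv.Perm (Fin n)) : floorHeight σ 0 = 0 := by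
  simp [floorHeight, prefixLis_zero, crossing_zero]

lemma Avoids.crossing_eq_zero {σ : Equiv.Perm (Fin n)} (h : Avoids σ pattern321) {t : Fin n}
    (ht : σ t = t) : crossing σ t = 0 := by
  rw [crossing, card_eq_zero, filter_eq_empty_iff]
  rintro i - ⟨h1, h2⟩
  have := h.lt_of_le_apply (i := i) ht.ge h1
  rw [ht] at this
  exact not_le.2 this h2

lemma crossing_pos_of_apply_lt {σ : Equiv.Perm (Fin n)} {t : Fin n} (ht : σ t < t) :
    0 < crossing σ t := by
  rw [← crossing_inv]
  exact crossing_pos (i := σ t) ht (by simp)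

/-- The floor rises at `t` exactly if the first path touches it and `t` is a weak anti-excedance
position, or the second path touches it and `t` is an excedance value. In these two cases a prefix
length grows although the type of the entry alone does not force it to. -/
lemma Avoids.floorHeight_succ {σ : Equiv.Perm (Fin n)} (h : Avoids σ pattern321) (t : Fin n) :
    ((floorHeight σ (t + 1) = floorHeight σ t ∧
        ¬ (σ t ≤ t ∧ prefixLis σ t + crossing σ t = prefixLis σ⁻¹ t) ∧
        ¬ (σ⁻¹ t < t ∧ prefixLis σ⁻¹ t + crossing σ t = prefixLis σ t)) ∨
      (floorHeight σ (t + 1) = floorHeight σ t + 1 ∧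
        (σ t ≤ t ∧ prefixLis σ t + crossing σ t = prefixLis σ⁻¹ t ∨
          σ⁻¹ t < t ∧ prefixLis σ⁻¹ t + crossing σ t = prefixLis σ t))) ∧
    (prefixLis σ (t + 1) = prefixLis σ t + 1 ↔
      t < σ t ∨ prefixLis σ t + crossing σ t = prefixLis σ⁻¹ t) ∧
    (prefixLis σ⁻¹ (t + 1) = prefixLis σ⁻¹ t + 1 ↔
      t ≤ σ⁻¹ t ∨ prefixLis σ⁻¹ t + crossing σ t = prefixLis σ t) := by
  have p1 := prefixLis_succ_le σ t
  have p2 := prefixLis_mono σ (Nat.le_succ t.val)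
  have q1 := prefixLis_succ_le σ⁻¹ t
  have q2 := prefixLis_mono σ⁻¹ (Nat.le_succ t.val)
  have c1 := crossing_succ σ t
  have a1 := prefixLis_le_inv σ t
  have a2 := prefixLis_le_inv σ (t + 1)
  have b1 := prefixLis_inv_le σ t
  have b2 := prefixLis_inv_le σ (t + 1)
  have p3 : t ≤ σ t → prefixLis σ (t + 1) = prefixLis σ t + 1 := h.prefixLis_succ (t := t)
  have q3 : t ≤ σ⁻¹ t → prefixLis σ⁻¹ (t + 1) = prefixLis σ⁻¹ t + 1 :=
    h.inv_321.prefixLis_succ (t := t)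
  have p4 : σ t < t → prefixLis σ (t + 1) = prefixLis σ t + 1 →
      prefixLis σ t + crossing σ t ≤ prefixLis σ⁻¹ t := h.prefixLis_add_crossing_le (t := t)
  have q4 : σ⁻¹ t < t → prefixLis σ⁻¹ (t + 1) = prefixLis σ⁻¹ t + 1 →
      prefixLis σ⁻¹ t + crossing σ⁻¹ t ≤ prefixLis σ⁻¹⁻¹ t :=
    h.inv_321.prefixLis_add_crossing_le (t := t)
  have p5 : σ t < t → 0 < crossing σ t := crossing_pos_of_apply_lt (σ := σ) (t := t)
  have q5 : σ⁻¹ t < t → 0 < crossing σ⁻¹ t := crossing_pos_of_apply_lt (σ := σ⁻¹) (t := t)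
  have f1 : σ t = t → crossing σ t = 0 := h.crossing_eq_zero (t := t)
  have f2 : σ t = t ↔ σ⁻¹ t = t := by rw [Equiv.Perm.inv_eq_iff_eq, eq_comm]
  rw [inv_inv, crossing_inv] at q4
  rw [crossing_inv] at q5
  simp only [Nat.succ_eq_add_one] at p2 q2
  unfold floorHeight
  push_cast
  simp only [Fin.lt_def, Fin.le_def, Fin.ext_iff] at *
  split_ifs at c1 <;> omega

lemma floorHeight_le (σ : Equiv.Perm (Fin n)) (t : ℕ) :
    floorHeight σ t ≤ 2 * min (prefixLis σ t) (prefixLis σ⁻¹ t) - t := by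
  have a1 := prefixLis_le_inv σ t
  have b1 := prefixLis_inv_le σ t
  unfold floorHeight
  push_cast
  omega

lemma Avoids.floorHeight_mono {σ : Equiv.Perm (Fin n)} (h : Avoids σ pattern321) {t u : ℕ}
    (htu : t ≤ u) (hu : u ≤ n) : floorHeight σ t ≤ floorHeight σ u := by
  induction u, htu using Nat.le_induction with
  | base => rfl
  | succ u _ ih =>
    have h1 := (h.floorHeight_succ ⟨u, hu⟩).1
    have h2 := ih (by omega)
    simp only at h1
    omega

/-- From any time on, one of the two paths returns to the current floor before it next rises. -/
lemma Avoids.exists_touch {σ : Equiv.Perm (Fin n)} (h : Avoids σ pattern321) {t : ℕ}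
    (ht : t ≤ n) : ∃ s, t ≤ s ∧ s ≤ n ∧
      floorHeight σ t = 2 * min (prefixLis σ s) (prefixLis σ⁻¹ s) - s := by
  induction ht using Nat.decreasingInduction with
  | self =>
    refine ⟨n, le_rfl, le_rfl, ?_⟩
    rw [floorHeight_self, prefixLis_inv_self, prefixLis_self]
    simp
  | of_succ t ht ih =>
    obtain ⟨s, h1, h2, h3⟩ := ih
    rcases (h.floorHeight_succ ⟨t, ht⟩).1 with h4 | h4
    · exact ⟨s, by omega, h2, by rw [← h3]; exact h4.1.symm⟩
    · refine ⟨t, le_rfl, by omega, ?_⟩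
      unfold floorHeight
      have := h4.2
      simp only at this
      push_cast
      omega

lemma Avoids.isFutureMin_iff {σ : Equiv.Perm (Fin n)} (h : Avoids σ pattern321) (t : Fin n) :
    IsFutureMin (lisDefect σ) (lisDefect σ⁻¹) n t ↔
      floorHeight σ (t + 1) = floorHeight σ t + 1 := by
  have hp := fun s => prefixLis_le σ s
  have hq := fun s => prefixLis_le σ⁻¹ s
  have hpt := hp t
  have hqt := hq t
  constructor
  · intro hmin
    by_contra hne
    have h1 : floorHeight σ (t + 1) = floorHeight σ t := by
      have := (h.floorHeight_succ t).1
      omega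
    obtain ⟨s, hs1, hs2, hs3⟩ := h.exists_touch (t := t + 1) t.2
    have h2 := hmin s (by omega) hs2
    have h3 := floorHeight_le σ t
    have hps := hp s
    have hqs := hq s
    unfold lisDefect at h2
    push_cast at *
    omega
  · intro hrise s hs1 hs2
    have h1 : floorHeight σ t = 2 * min (prefixLis σ t) (prefixLis σ⁻¹ t) - t := by
      have := (h.floorHeight_succ t).1
      unfold floorHeight at this hrise ⊢
      push_cast at *
      omega
    have h2 := floorHeight_le σ s
    have h3 := h.floorHeight_mono (t := t + 1) hs1 hs2
    have hps := hp s
    have hqs := hq s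
    unfold lisDefect
    push_cast at *
    omega

/-- A path that never descends below the floor, which starts at height `0` and never falls, is a
ballot path. -/
lemma Avoids.le_two_mul_prefixLis {σ : Equiv.Perm (Fin n)} (h : Avoids σ pattern321) {t : ℕ}
    (ht : t ≤ n) : t ≤ 2 * prefixLis σ t := by
  have h1 := floorHeight_le σ t
  have h2 := h.floorHeight_mono (Nat.zero_le t) ht
  rw [floorHeight_zero] at h2
  push_cast at *
  omega

lemma card_filter_range_eq (P : ℕ → Prop) [DecidablePred P] :
    #{t ∈ range n | P t} = #{t : Fin n | P t} := by
  rw [← card_map Fin.valEmbedding]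
  congr 1
  ext t
  simp only [mem_filter, mem_range, mem_map, mem_univ, true_and, Fin.valEmbedding_apply]
  exact ⟨fun h => ⟨⟨t, h.1⟩, h.2, rfl⟩, by rintro ⟨a, ha, rfl⟩; exact ⟨a.2, ha⟩⟩

lemma Avoids.fp_eq_numTies {σ : Equiv.Perm (Fin n)} (h : Avoids σ pattern321) :
    fp σ = numTies (lisDefect σ) (lisDefect σ⁻¹) n := by
  classical
  rw [numTies, card_filter_range_eq, fp]
  congr 1
  ext t
  simp only [mem_filter, mem_univ, true_and]
  rw [h.isFutureMin_iff]
  have h1 := (h.floorHeight_succ t).1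
  have hpt := prefixLis_le σ t
  have hqt := prefixLis_le σ⁻¹ t
  have a1 := prefixLis_le_inv σ t
  have b1 := prefixLis_inv_le σ t
  have p5 : σ t < t → 0 < crossing σ t := crossing_pos_of_apply_lt (σ := σ) (t := t)
  have q5 : σ⁻¹ t < t → 0 < crossing σ⁻¹ t := crossing_pos_of_apply_lt (σ := σ⁻¹) (t := t)
  have f1 : σ t = t → crossing σ t = 0 := h.crossing_eq_zero (t := t)
  rw [crossing_inv] at q5
  simp only [Fin.lt_def, Fin.le_def, Fin.ext_iff, lisDefect] at *
  omega

lemma card_filter_rise (σ : Equiv.Perm (Fin n)) {m : ℕ} (hm : m ≤ n) :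
    #{t ∈ range m | prefixLis σ (t + 1) = prefixLis σ t + 1} = prefixLis σ m := by
  induction m with
  | zero => simp [prefixLis_zero]
  | succ m ih =>
    have h1 := prefixLis_succ_le σ m
    have h2 := prefixLis_mono σ (Nat.le_succ m)
    rw [Nat.succ_eq_add_one] at h2
    rw [range_add_one, filter_insert]
    split_ifs with h
    · rw [card_insert_of_notMem (by simp), ih (by omega), h]
    · rw [ih (by omega)]
      omega

lemma Avoids.exc_add_lis {σ : Equiv.Perm (Fin n)} (h : Avoids σ pattern321) :
    exc σ + lis σ = n + numSecondLower (lisDefect σ) (lisDefect σ⁻¹) n := by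
  classical
  have h1 : exc σ = #{v : Fin n | σ⁻¹ v < v} := by
    rw [exc, ← card_map σ.toEmbedding]
    congr 1
    ext v
    simp only [mem_map_equiv, mem_filter, mem_univ, true_and]
    simp [Equiv.Perm.inv_def]
  have h2 : lis σ = #{v : Fin n | prefixLis σ⁻¹ (v + 1) = prefixLis σ⁻¹ v + 1} := by
    rw [← prefixLis_inv_self, ← card_filter_rise σ⁻¹ le_rfl]
    exact card_filter_range_eq fun t => prefixLis σ⁻¹ (t + 1) = prefixLis σ⁻¹ t + 1
  -- every value is an excedance value or lengthens the increasing subsequence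
  have h3 : ({v : Fin n | σ⁻¹ v < v} : Finset _) ∪
      ({v : Fin n | prefixLis σ⁻¹ (v + 1) = prefixLis σ⁻¹ v + 1} : Finset _) = univ := by
    ext v
    simp only [mem_union, mem_filter, mem_univ, true_and, iff_true]
    have := (h.floorHeight_succ v).2.2
    rw [this, ← not_lt]
    tauto
  have h4 : ({v : Fin n | σ⁻¹ v < v} : Finset _) ∩
      ({v : Fin n | prefixLis σ⁻¹ (v + 1) = prefixLis σ⁻¹ v + 1} : Finset _) =
      ({t : Fin n | IsFutureMin (lisDefect σ) (lisDefect σ⁻¹) n t ∧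
        lisDefect σ t < lisDefect σ⁻¹ t} : Finset _) := by
    ext t
    simp only [mem_inter, mem_filter, mem_univ, true_and]
    rw [h.isFutureMin_iff]
    have h1 := h.floorHeight_succ t
    have hpt := prefixLis_le σ t
    have hqt := prefixLis_le σ⁻¹ t
    have q5 : σ⁻¹ t < t → 0 < crossing σ⁻¹ t := crossing_pos_of_apply_lt (σ := σ⁻¹) (t := t)
    rw [crossing_inv] at q5
    simp only [Fin.lt_def, Fin.le_def, lisDefect] at *
    omega
  rw [numSecondLower, card_filter_range_eq, ← h4, h1, h2, ← card_union_add_card_inter, h3]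
  simp

/-- Two permutations that are increasing on `s` and have the same image of `s` agree on `s`. -/
lemma eqOn_of_strictMonoOn {σ τ : Equiv.Perm (Fin n)} {s : Set (Fin n)} (hσ : StrictMonoOn σ s)
    (hτ : StrictMonoOn τ s) (himg : σ '' s = τ '' s) : Set.EqOn σ τ s := by
  have key : ∀ σ τ : Equiv.Perm (Fin n), StrictMonoOn τ s → σ '' s = τ '' s → ∀ i ∈ s,
      (∀ j ∈ s, j < i → σ j = τ j) → ¬ σ i < τ i := by
    intro σ τ hτ himg i hi hj hlt
    obtain ⟨k, hk, hke⟩ : σ i ∈ τ '' s := himg ▸ Set.mem_image_of_mem σ hi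
    have hki : k < i := (hτ.lt_iff_lt hk hi).1 (hke ▸ hlt)
    have := hj k hk hki
    exact hki.ne (σ.injective (this.trans hke))
  intro i
  induction i using WellFoundedLT.induction with
  | ind i ih =>
    intro hi
    have h1 := key σ τ hτ himg i hi fun j hj hji => ih j hji hj
    have h2 := key τ σ hσ himg.symm i hi fun j hj hji => (ih j hji hj).symm
    exact le_antisymm (not_lt.1 h2) (not_lt.1 h1)

lemma Avoids.lt_apply_iff {σ : Equiv.Perm (Fin n)} (h : Avoids σ pattern321) (t : Fin n) :
    t < σ t ↔ prefixLis σ (t + 1) = prefixLis σ t + 1 ∧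
      ¬ (floorHeight σ (t + 1) = floorHeight σ t + 1 ∧
        prefixLis σ t + crossing σ t = prefixLis σ⁻¹ t) := by
  have h1 := h.floorHeight_succ t
  have q5 : σ⁻¹ t < t → 0 < crossing σ⁻¹ t := crossing_pos_of_apply_lt (σ := σ⁻¹) (t := t)
  rw [crossing_inv] at q5
  simp only [Fin.lt_def, Fin.le_def] at *
  omega

/-- A 321-avoiding permutation is determined by the lengths of the longest increasing subsequences
of its prefixes and of those of its inverse: they determine the floor, hence the positions and the
values of the excedances. -/
lemma Avoids.eq_of_prefixLis_eq {σ τ : Equiv.Perm (Fin n)} (hσ : Avoids σ pattern321)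
    (hτ : Avoids τ pattern321) (hp : ∀ t ≤ n, prefixLis σ t = prefixLis τ t)
    (hq : ∀ t ≤ n, prefixLis σ⁻¹ t = prefixLis τ⁻¹ t) : σ = τ := by
  have hrise : ∀ t : Fin n, floorHeight σ (t + 1) = floorHeight σ t + 1 ↔
      floorHeight τ (t + 1) = floorHeight τ t + 1 := by
    intro t
    rw [← hσ.isFutureMin_iff, ← hτ.isFutureMin_iff]
    exact IsFutureMin.congr (fun s hs => by rw [lisDefect, hp s hs, lisDefect])
      (fun s hs => by rw [lisDefect, hq s hs, lisDefect]) t.2.le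
  have hfloor : ∀ t ≤ n, floorHeight σ t = floorHeight τ t := by
    intro t
    induction t with
    | zero => intro; rw [floorHeight_zero, floorHeight_zero]
    | succ t ih =>
      intro ht
      have h1 := ih (by omega)
      have h2 := hrise ⟨t, ht⟩
      have h3 := (hσ.floorHeight_succ ⟨t, ht⟩).1
      have h4 := (hτ.floorHeight_succ ⟨t, ht⟩).1
      simp only at h2 h3 h4
      omega
  have hcross : ∀ t ≤ n, crossing σ t = crossing τ t := by
    intro t ht
    have := hfloor t ht
    rw [floorHeight, floorHeight, hp t ht, hq t ht] at this
    omega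
  have hpos : ∀ t : Fin n, t < σ t ↔ t < τ t := by
    intro t
    rw [hσ.lt_apply_iff, hτ.lt_apply_iff, hrise, hp _ t.2, hp _ t.2.le, hq _ t.2.le,
      hcross _ t.2.le]
  have hval : ∀ t : Fin n, σ⁻¹ t < t ↔ τ⁻¹ t < t := by
    intro t
    have h1 := crossing_succ σ t
    have h2 := crossing_succ τ t
    rw [hcross (t + 1) t.2, hcross t t.2.le] at h1
    simp only [hpos] at h1
    have h3 : (if σ⁻¹ t < t then 1 else 0) = if τ⁻¹ t < t then 1 else 0 := by omega
    split_ifs at h3 <;> tauto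
  have himg : ∀ ρ : Equiv.Perm (Fin n), ρ '' {t | t < ρ t} = {v | ρ⁻¹ v < v} := by
    intro ρ
    ext v
    simp only [Set.mem_image, Set.mem_ofPred_eq]
    exact ⟨by rintro ⟨t, ht, rfl⟩; simpa using ht, fun hv => ⟨ρ⁻¹ v, by simpa using hv, by simp⟩⟩
  have hup : ∀ {ρ : Equiv.Perm (Fin n)}, Avoids ρ pattern321 → StrictMonoOn ρ {t | t < ρ t} :=
    fun hρ a _ b hb hab => hρ.lt_of_le_apply (le_of_lt hb) hab
  have hlow : ∀ {ρ : Equiv.Perm (Fin n)}, Avoids ρ pattern321 → StrictMonoOn ρ {t | t < ρ t}ᶜ :=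
    fun hρ a ha b _ hab => hρ.lt_of_apply_le (not_lt.1 ha) hab
  have hset : {t : Fin n | t < σ t} = {t | t < τ t} := Set.ext hpos
  have himg' : σ '' {t | t < σ t} = τ '' {t | t < σ t} := by
    rw [himg, hset, himg]
    exact Set.ext hval
  ext1 i
  by_cases hi : i ∈ {t : Fin n | t < σ t}
  · exact eqOn_of_strictMonoOn (hup hσ) (hset ▸ hup hτ) himg' hi
  · refine eqOn_of_strictMonoOn (hlow hσ) (hset ▸ hlow hτ) ?_ hi
    rw [Set.image_compl_eq σ.bijective, Set.image_compl_eq τ.bijective, himg']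

/-! ### The two paths of a 132-avoiding permutation -/

/-- The largest `k ≤ n` such that the first `k` values of `σ` are at least `k + s` (counted from
`0`). For `s = 0` this is the rank. -/
def shiftedRank (σ : Equiv.Perm (Fin n)) (s : ℕ) : ℕ :=
  Nat.findGreatest (fun k => ∀ i : Fin n, i.val < k → k + s ≤ (σ i).val) n

lemma shiftedRank_zero (σ : Equiv.Perm (Fin n)) : shiftedRank σ 0 = rank σ := by
  unfold shiftedRank rank
  congr! 4 with k
  omega

lemma le_shiftedRank_iff {σ : Equiv.Perm (Fin n)} {s k : ℕ} :
    k ≤ shiftedRank σ s ↔ k ≤ n ∧ ∀ i : Fin n, i.val < k → k + s ≤ (σ i).val := by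
  constructor
  · intro hk
    have h1 := Nat.findGreatest_spec
      (P := fun k => ∀ i : Fin n, i.val < k → k + s ≤ (σ i).val) (Nat.zero_le n) (by simp)
    refine ⟨hk.trans (Nat.findGreatest_le n), fun i hi => ?_⟩
    have := h1 i (hi.trans_le hk)
    exact (Nat.add_le_add_right hk s).trans this
  · rintro ⟨hk, h⟩
    exact Nat.le_findGreatest hk h

lemma shiftedRank_antitone (σ : Equiv.Perm (Fin n)) : Antitone (shiftedRank σ) := by
  intro s s' hs
  have h := le_shiftedRank_iff.1 (le_refl (shiftedRank σ s'))
  exact le_shiftedRank_iff.2 ⟨h.1, fun i hi => by have := h.2 i hi; omega⟩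

lemma shiftedRank_inv_zero (σ : Equiv.Perm (Fin n)) : shiftedRank σ⁻¹ 0 = shiftedRank σ 0 := by
  refine eq_of_forall_le_iff fun k => ?_
  rw [le_shiftedRank_iff, le_shiftedRank_iff]
  refine and_congr_right fun _ => ⟨fun h i hi => ?_, fun h i hi => ?_⟩
  · by_contra hc
    have := h (σ i) (by omega)
    simp only [perm_inv_apply] at this
    omega
  · by_contra hc
    have := h (σ⁻¹ i) (by omega)
    simp only [perm_apply_inv] at this
    omega

lemma add_two_mul_shiftedRank_le (σ : Equiv.Perm (Fin n)) {s : ℕ} (hs : s ≤ n) :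
    s + 2 * shiftedRank σ s ≤ n := by
  obtain ⟨hk, h⟩ := le_shiftedRank_iff.1 (le_refl (shiftedRank σ s))
  set k := shiftedRank σ s
  rcases Nat.eq_zero_or_pos k with h0 | h0
  · omega
  have h1 := h ⟨0, by omega⟩ h0
  have h2 := (σ ⟨0, by omega⟩).2
  have hsub : ({i : Fin n | i.val < k} : Finset _).image σ ⊆ Finset.Ici ⟨k + s, by omega⟩ := by
    intro v hv
    simp only [mem_image, mem_filter, mem_univ, true_and] at hv
    obtain ⟨i, hi, rfl⟩ := hv
    simpa [Fin.le_def] using h i hi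
  have := card_le_card hsub
  rw [card_image_of_injective _ σ.injective, Fin.card_Ici] at this
  simp only [Fin.card_filter_val_lt] at this
  omega

/-- The smallest value of `σ` at positions `≤ w`. -/
def runMin (σ : Equiv.Perm (Fin n)) (w : Fin n) : Fin n :=
  (Finset.Iic w).inf' ⟨w, by simp⟩ σ

lemma runMin_le {σ : Equiv.Perm (Fin n)} {i w : Fin n} (h : i ≤ w) : runMin σ w ≤ σ i :=
  Finset.inf'_le _ (by simpa using h)

lemma inv_runMin_le (σ : Equiv.Perm (Fin n)) (w : Fin n) : σ⁻¹ (runMin σ w) ≤ w := by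
  obtain ⟨i, hi, he⟩ := Finset.exists_mem_eq_inf' (s := Finset.Iic w) ⟨w, by simp⟩ σ
  rw [runMin, he]
  simpa using hi

/-- An entry between the first entry with value at most `σ w` and `w` itself is smaller than
`σ w`. -/
lemma Avoids.apply_lt_of_runMin_le {σ : Equiv.Perm (Fin n)} (h : Avoids σ pattern132)
    {i w : Fin n} (hi : runMin σ⁻¹ (σ w) ≤ i) (hiw : i < w) : σ i < σ w := by
  rw [avoids_pattern132_iff] at h
  by_contra hc
  have hwi : σ w < σ i := lt_of_le_of_ne (not_lt.1 hc) fun e => hiw.ne' (σ.injective e)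
  have h1 := inv_runMin_le σ⁻¹ (σ w)
  rw [inv_inv] at h1
  set a := runMin σ⁻¹ (σ w)
  have h2 : σ a < σ w := lt_of_le_of_ne h1 fun e => (hi.trans_lt hiw).ne (σ.injective e)
  have h3 : a < i := lt_of_le_of_ne hi fun e => by rw [e] at h2; exact lt_asymm h2 hwi
  exact h a i w h3 hiw h2 hwi

lemma Avoids.sub_runMin_le {σ : Equiv.Perm (Fin n)} (h : Avoids σ pattern132) (w : Fin n) :
    w.val - (runMin σ⁻¹ (σ w)).val ≤ (σ w).val - (runMin σ w).val := by
  have hsub : (Finset.Ico (runMin σ⁻¹ (σ w)) w).image σ ⊆ Finset.Ico (runMin σ w) (σ w) := by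
    intro v hv
    simp only [mem_image, mem_Ico] at hv ⊢
    obtain ⟨i, ⟨h1, h2⟩, rfl⟩ := hv
    exact ⟨runMin_le h2.le, h.apply_lt_of_runMin_le h1 h2⟩
  have := card_le_card hsub
  rwa [card_image_of_injective _ σ.injective, Fin.card_Ico, Fin.card_Ico] at this

/-- In the Dyck path of `σ`, the down step of position `w` closes the up step of value `σ w`.
Between the two there are as many up steps, of the values from `runMin σ w` to `σ w - 1`, as there
are down steps, of the positions from `runMin σ⁻¹ (σ w)` to `w - 1`. -/
lemma Avoids.add_runMin_inv {σ : Equiv.Perm (Fin n)} (h : Avoids σ pattern132) (w : Fin n) :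
    (σ w).val + (runMin σ⁻¹ (σ w)).val = w.val + (runMin σ w).val := by
  have h1 := h.sub_runMin_le w
  have h2 := h.inv_132.sub_runMin_le (σ w)
  simp only [inv_inv, perm_inv_apply] at h2
  have h3 : runMin σ w ≤ σ w := runMin_le le_rfl
  have h4 : runMin σ⁻¹ (σ w) ≤ σ⁻¹ (σ w) := runMin_le le_rfl
  simp only [perm_inv_apply] at h4
  rw [Fin.le_def] at h3 h4
  omega

lemma shiftedRank_inv_runMin {σ : Equiv.Perm (Fin n)} {w : Fin n} {s : ℕ}
    (hs : s + (runMin σ w).val = w + 1) : shiftedRank σ⁻¹ s = (runMin σ w).val := by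
  refine le_antisymm ?_ ?_
  · by_contra! hc
    have h1 := (le_shiftedRank_iff.1 (Nat.succ_le_of_lt hc)).2 (runMin σ w) (by omega)
    have h2 := inv_runMin_le σ w
    rw [Fin.le_def] at h2
    omega
  · refine le_shiftedRank_iff.2 ⟨(runMin σ w).2.le, fun j hj => ?_⟩
    by_contra! hc
    have : σ⁻¹ j ≤ w := by rw [Fin.le_def]; omega
    have := runMin_le (σ := σ) this
    simp only [perm_apply_inv, Fin.le_def] at this
    omega

/-- The entry at position `w` lies beyond the rank square in both directions. Its two steps lie in
different halves of the Dyck path. -/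
def IsOuter (σ : Equiv.Perm (Fin n)) (w : Fin n) : Prop :=
  shiftedRank σ 0 ≤ w ∧ shiftedRank σ 0 ≤ σ w

lemma IsOuter.inv {σ : Equiv.Perm (Fin n)} {w : Fin n} (h : IsOuter σ w) :
    IsOuter σ⁻¹ (σ w) := by
  rw [IsOuter, shiftedRank_inv_zero]
  exact ⟨h.2, by rw [perm_inv_apply]; exact h.1⟩

lemma IsOuter.runMin_le_rank {σ : Equiv.Perm (Fin n)} {w : Fin n} (h : IsOuter σ w) :
    (runMin σ w).val ≤ shiftedRank σ 0 := by
  by_contra! hc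
  have hw := w.2
  have h1 := h.1
  have : shiftedRank σ 0 + 1 ≤ shiftedRank σ 0 := by
    refine le_shiftedRank_iff.2 ⟨by omega, fun i hi => ?_⟩
    have := runMin_le (σ := σ) (i := i) (w := w) (by rw [Fin.le_def]; omega)
    rw [Fin.le_def] at this
    omega
  omega

/-- After the step that belongs to the position `w` of an outer entry, the path of `σ⁻¹` stays above
the height that it has just before this step. Here `s` is the number of steps that remain. -/
lemma Avoids.add_two_mul_shiftedRank_lt {σ : Equiv.Perm (Fin n)} (h : Avoids σ pattern132)
    {w : Fin n} (hw : IsOuter σ w) {s : ℕ} (hs : s + (runMin σ w).val ≤ w) :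
    s + 2 * shiftedRank σ⁻¹ s < w.val + 1 + (runMin σ w).val := by
  by_contra! hc
  obtain ⟨-, hfit⟩ := le_shiftedRank_iff.1 (le_refl (shiftedRank σ⁻¹ s))
  have hkr : shiftedRank σ⁻¹ s ≤ shiftedRank σ 0 := by
    rw [← shiftedRank_inv_zero]
    exact shiftedRank_antitone _ (Nat.zero_le s)
  set k := shiftedRank σ⁻¹ s
  have hkv : k ≤ (σ w).val := hkr.trans hw.2
  have h1 := hfit (runMin σ w) (by omega)
  have h2 := inv_runMin_le σ w
  rw [Fin.le_def] at h2
  have hk : k < n := hkv.trans_lt (σ w).2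
  have hks : k + s < n := (h1.trans h2).trans_lt w.2
  -- the values in `[runMin σ w, k)` have positions in `[k + s, w)`
  have hsub : (Finset.Ico (runMin σ w) ⟨k, hk⟩).image ⇑σ⁻¹ ⊆ Finset.Ico ⟨k + s, hks⟩ w := by
    intro i hi
    simp only [mem_image, mem_Ico] at hi ⊢
    obtain ⟨j, ⟨hj1, hj2⟩, rfl⟩ := hi
    rw [Fin.lt_def] at hj2
    have h3 := h.inv_132.apply_lt_of_runMin_le (w := σ w) (i := j)
    simp only [inv_inv, perm_inv_apply] at h3
    exact ⟨hfit j hj2, h3 hj1 (lt_of_lt_of_le hj2 hkv)⟩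
  have := card_le_card hsub
  rw [card_image_of_injective _ σ⁻¹.injective, Fin.card_Ico, Fin.card_Ico] at this
  simp only at this
  omega

/-- The number of down steps among the first `t ≤ n` steps of the Dyck path of `σ`. -/
def downCount (σ : Equiv.Perm (Fin n)) (t : ℕ) : ℕ := shiftedRank σ (n - t)

/-- An outer entry that is a weak excedance gives a strict future minimum of the two paths, at the
step of its position. -/
lemma Avoids.isFutureMin_of_isOuter {σ : Equiv.Perm (Fin n)} (h : Avoids σ pattern132)
    {w : Fin n} (hw : IsOuter σ w) (hle : w ≤ σ w) :
    ∃ t < n, t + w.val + 1 = n + (runMin σ w).val ∧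
      IsFutureMin (downCount σ) (downCount σ⁻¹) n t ∧ downCount σ⁻¹ t = (runMin σ w).val ∧
      (w = σ w → downCount σ t = downCount σ⁻¹ t) ∧
      (w < σ w → downCount σ t < downCount σ⁻¹ t) := by
  have hmr := hw.runMin_le_rank
  have hrw := hw.1
  have hwn := w.2
  have htun := h.add_runMin_inv w
  have hvn := (σ w).2
  have hC := fun s => h.add_two_mul_shiftedRank_lt hw (s := s)
  have hC' := fun s => h.inv_132.add_two_mul_shiftedRank_lt hw.inv (s := s)
  simp only [inv_inv] at hC'
  have hB := fun s => shiftedRank_inv_runMin (σ := σ) (w := w) (s := s)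
  have hB' := fun s => shiftedRank_inv_runMin (σ := σ⁻¹) (w := σ w) (s := s)
  simp only [inv_inv] at hB'
  rw [Fin.le_def] at hle
  set m := (runMin σ w).val
  set c := (runMin σ⁻¹ (σ w)).val
  have hns : n - (n + m - (w + 1)) = w + 1 - m := by omega
  have hB1 := hB (w + 1 - m) (by omega)
  refine ⟨n + m - (w + 1), by omega, by omega, ?_, ?_, ?_, ?_⟩
  · intro u hu hun
    have h1 := hC (n - u) (by omega)
    have h2 := hC' (n - u) (by omega)
    unfold downCount
    rw [hns, hB1]
    omega
  · rw [downCount, hns, hB1]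
  · intro he
    rw [Fin.ext_iff] at he
    have := hB' (w + 1 - m) (by omega)
    rw [downCount, downCount, hns, hB1, this]
    omega
  · intro hlt
    rw [Fin.lt_def] at hlt
    have := hC' (w + 1 - m) (by omega)
    rw [downCount, downCount, hns, hB1]
    omega

open scoped Classical in
lemma Avoids.card_outer_fixed_le {σ : Equiv.Perm (Fin n)} (h : Avoids σ pattern132) :
    #{w : Fin n | IsOuter σ w ∧ w = σ w} ≤ numTies (downCount σ) (downCount σ⁻¹) n := by
  have hmap := fun (w : Fin n) (hw : IsOuter σ w ∧ w = σ w) =>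
    h.isFutureMin_of_isOuter hw.1 (le_of_eq hw.2)
  choose! f hf using hmap
  refine card_le_card_of_injOn f ?_ ?_
  · intro w hw
    simp only [coe_filter, mem_univ, true_and, Set.mem_ofPred_eq] at hw
    have := hf w hw
    simp only [coe_filter, mem_range, Set.mem_ofPred_eq]
    exact ⟨this.1, this.2.2.1, this.2.2.2.2.1 hw.2⟩
  · intro a ha b hb hab
    simp only [coe_filter, mem_univ, true_and, Set.mem_ofPred_eq] at ha hb
    have h1 := hf a ha
    have h2 := hf b hb
    have h3 := h1.2.2.2.1
    rw [hab, h2.2.2.2.1] at h3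
    exact Fin.ext (by omega)

open scoped Classical in
lemma Avoids.card_outer_exc_le {σ : Equiv.Perm (Fin n)} (h : Avoids σ pattern132) :
    #{w : Fin n | IsOuter σ w ∧ w < σ w} ≤ numSecondLower (downCount σ) (downCount σ⁻¹) n := by
  have hmap := fun (w : Fin n) (hw : IsOuter σ w ∧ w < σ w) =>
    h.isFutureMin_of_isOuter hw.1 (le_of_lt hw.2)
  choose! f hf using hmap
  refine card_le_card_of_injOn f ?_ ?_
  · intro w hw
    simp only [coe_filter, mem_univ, true_and, Set.mem_ofPred_eq] at hw
    have := hf w hw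
    simp only [coe_filter, mem_range, Set.mem_ofPred_eq]
    exact ⟨this.1, this.2.2.1, this.2.2.2.2.2 hw.2⟩
  · intro a ha b hb hab
    simp only [coe_filter, mem_univ, true_and, Set.mem_ofPred_eq] at ha hb
    have h1 := hf a ha
    have h2 := hf b hb
    have h3 := h1.2.2.2.1
    rw [hab, h2.2.2.2.1] at h3
    exact Fin.ext (by omega)

lemma downCount_le (σ : Equiv.Perm (Fin n)) {t : ℕ} (ht : t ≤ n) : 2 * downCount σ t ≤ t := by
  have := add_two_mul_shiftedRank_le σ (s := n - t) (by omega)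
  unfold downCount
  omega

lemma downCount_self (σ : Equiv.Perm (Fin n)) : downCount σ n = rank σ := by
  rw [downCount, Nat.sub_self, shiftedRank_zero]

open scoped Classical in
/-- The heights of the strict future minima are distinct and lie between `0` and the final
height. -/
lemma card_isFutureMin_le {x y : ℕ → ℕ} {r : ℕ} (hx : ∀ t ≤ n, 2 * x t ≤ t)
    (hy : ∀ t ≤ n, 2 * y t ≤ t) (hxn : x n = r) (hyn : y n = r) :
    #{t ∈ range n | IsFutureMin x y n t} + 2 * r ≤ n := by
  have hr := hx n le_rfl
  have : #{t ∈ range n | IsFutureMin x y n t} ≤ #(range (n - 2 * r)) := by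
    refine card_le_card_of_injOn (fun t => t - 2 * max (x t) (y t)) ?_ ?_
    · intro t ht
      simp only [coe_filter, mem_range, Set.mem_ofPred_eq, coe_range, Set.mem_Iio] at ht ⊢
      have h1 := ht.2 n ht.1 le_rfl
      have := hx t ht.1.le
      have := hy t ht.1.le
      omega
    · have key : ∀ a b, b < n → IsFutureMin x y n a → a < b →
          a - 2 * max (x a) (y a) ≠ b - 2 * max (x b) (y b) := by
        intro a b hb ha hab
        have h1 := ha b hab hb.le
        have := hx a (by omega)
        have := hy a (by omega)
        have := hx b hb.le
        have := hy b hb.le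
        omega
      intro a ha b hb hab
      simp only [coe_filter, mem_range, Set.mem_ofPred_eq] at ha hb
      rcases lt_trichotomy a b with hlt | he | hlt
      · exact absurd hab (key a b hb.1 ha.2 hlt)
      · exact he
      · exact absurd hab.symm (key b a ha.1 hb.2 hlt)
  rw [card_range] at this
  omega

open scoped Classical in
lemma numTies_add_numSecondLower (x y : ℕ → ℕ) :
    numTies x y n + numSecondLower x y n + numSecondLower y x n =
      #{t ∈ range n | IsFutureMin x y n t} := by
  have hsw : ∀ t, IsFutureMin y x n t ↔ IsFutureMin x y n t := fun t => ⟨.swap, .swap⟩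
  unfold numTies numSecondLower
  simp only [hsw]
  rw [← card_union_of_disjoint, ← card_union_of_disjoint]
  · congr 1
    ext t
    simp only [mem_union, mem_filter, ← and_or_left]
    have := lt_trichotomy (x t) (y t)
    tauto
  · rw [disjoint_left]
    simp only [mem_union, mem_filter]
    omega
  · rw [disjoint_left]
    simp only [mem_filter]
    omega

open scoped Classical in
lemma card_isOuter (σ : Equiv.Perm (Fin n)) :
    #{w : Fin n | IsOuter σ w} + 2 * shiftedRank σ 0 = n := by
  obtain ⟨hr, hfit⟩ := le_shiftedRank_iff.1 (le_refl (shiftedRank σ 0))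
  have h0 : #{w : Fin n | IsOuter σ w} =
      #{w : Fin n | ¬ w.val < shiftedRank σ 0 ∧ ¬ (σ w).val < shiftedRank σ 0} := by
    congr 1
    ext w
    simp only [mem_filter, mem_univ, true_and, not_lt]
    rfl
  set r := shiftedRank σ 0
  have h1 := card_filter_add_card_filter_not (s := (univ : Finset (Fin n))) (fun w => w.val < r)
  have h2 := card_filter_add_card_filter_not
    (s := ({w : Fin n | ¬ w.val < r} : Finset _)) (fun w => (σ w).val < r)
  simp only [filter_filter] at h2
  have h3 : #{w : Fin n | ¬ w.val < r ∧ (σ w).val < r} = #{v : Fin n | v.val < r} := by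
    rw [← card_map σ.toEmbedding]
    congr 1
    ext v
    simp only [mem_map_equiv, mem_filter, mem_univ, true_and, Equiv.apply_symm_apply,
      and_iff_right_iff_imp]
    intro hv hc
    have := hfit _ hc
    simp only [Equiv.apply_symm_apply] at this
    omega
  rw [card_univ, Fintype.card_fin] at h1
  have h4 : #{v : Fin n | v.val < r} = r := by rw [Fin.card_filter_val_lt, min_eq_right hr]
  omega

open scoped Classical in
/-- The inequalities `card_outer_fixed_le` and `card_outer_exc_le`, the latter for `σ` and for
`σ⁻¹`, are equalities, because their two sides have the same sum. -/
lemma Avoids.card_outer_eq {σ : Equiv.Perm (Fin n)} (h : Avoids σ pattern132) :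
    #{w : Fin n | IsOuter σ w ∧ w = σ w} = numTies (downCount σ) (downCount σ⁻¹) n ∧
    #{w : Fin n | IsOuter σ w ∧ w < σ w} =
      numSecondLower (downCount σ) (downCount σ⁻¹) n := by
  have h1 := h.card_outer_fixed_le
  have h2 := h.card_outer_exc_le
  have h3 := h.inv_132.card_outer_exc_le
  rw [inv_inv] at h3
  have h4 : #{w : Fin n | IsOuter σ⁻¹ w ∧ w < σ⁻¹ w} = #{w : Fin n | IsOuter σ w ∧ σ w < w} := by
    symm
    rw [← card_map σ.toEmbedding]
    congr 1
    ext v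
    rw [mem_map_equiv, ← Equiv.Perm.inv_def]
    simp only [mem_filter, mem_univ, true_and]
    simp only [IsOuter, shiftedRank_inv_zero, perm_apply_inv]
    tauto
  have h5 := numTies_add_numSecondLower (n := n) (downCount σ) (downCount σ⁻¹)
  have h6 := card_isFutureMin_le (fun t => downCount_le σ (t := t))
    (fun t => downCount_le σ⁻¹ (t := t)) (downCount_self σ)
    (by rw [downCount_self, ← shiftedRank_zero, shiftedRank_inv_zero, shiftedRank_zero])
  have h7 := card_isOuter σ
  rw [shiftedRank_zero] at h7
  have h8 : #{w : Fin n | IsOuter σ w} = #{w : Fin n | IsOuter σ w ∧ w = σ w} +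
      #{w : Fin n | IsOuter σ w ∧ w < σ w} + #{w : Fin n | IsOuter σ w ∧ σ w < w} := by
    rw [← card_union_of_disjoint, ← card_union_of_disjoint]
    · congr 1
      ext t
      simp only [mem_union, mem_filter, mem_univ, true_and]
      have := lt_trichotomy t (σ t)
      tauto
    · rw [disjoint_left]
      simp only [mem_union, mem_filter, Fin.ext_iff, Fin.lt_def]
      omega
    · rw [disjoint_left]
      simp only [mem_filter, Fin.ext_iff, Fin.lt_def]
      omega
  omega

lemma Avoids.fp_eq_numTies_downCount {σ : Equiv.Perm (Fin n)} (h : Avoids σ pattern132) :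
    fp σ = numTies (downCount σ) (downCount σ⁻¹) n := by
  classical
  obtain ⟨-, hfit⟩ := le_shiftedRank_iff.1 (le_refl (shiftedRank σ 0))
  rw [← h.card_outer_eq.1, fp]
  congr 1
  ext w
  simp only [mem_filter, mem_univ, true_and]
  simp only [IsOuter]
  have := hfit w
  simp only [Fin.ext_iff]
  omega

lemma Avoids.exc_eq_rank_add {σ : Equiv.Perm (Fin n)} (h : Avoids σ pattern132) :
    exc σ = rank σ + numSecondLower (downCount σ) (downCount σ⁻¹) n := by
  classical
  obtain ⟨hr, hfit⟩ := le_shiftedRank_iff.1 (le_refl (shiftedRank σ 0))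
  have h4 : #{v : Fin n | v.val < shiftedRank σ 0} = shiftedRank σ 0 := by
    rw [Fin.card_filter_val_lt, min_eq_right hr]
  rw [← h.card_outer_eq.2, ← shiftedRank_zero, exc]
  suffices hsum : #{w : Fin n | w < σ w} =
      #{v : Fin n | v.val < shiftedRank σ 0} + #{w : Fin n | IsOuter σ w ∧ w < σ w} by
    rw [h4] at hsum
    exact hsum
  rw [← card_union_of_disjoint]
  · congr 1
    ext w
    simp only [mem_filter, mem_univ, true_and, mem_union]
    simp only [IsOuter]
    have := hfit w
    rw [Fin.lt_def]
    omega
  · rw [disjoint_left]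
    simp only [mem_filter, mem_univ, true_and]
    simp only [IsOuter]
    omega

/-! ### Permutations with prescribed running minima -/

/-- If the relation `P`, "`v` is large enough to be placed at position `i`", weakens as `i` and `v`
grow and holds along the antidiagonal, then the lexicographically smallest permutation with values
allowed by `P` avoids 132, and its running minima are the smallest values allowed by `P`. -/
lemma exists_avoids_132_of_lower_bound (P : Fin n → Fin n → Prop)
    (hP : ∀ i j v w, P i v → i ≤ j → v ≤ w → P j w) (hrev : ∀ i, P i (Fin.rev i)) :
    ∃ τ : Equiv.Perm (Fin n), Avoids τ pattern132 ∧ (∀ i, P i (τ i)) ∧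
      ∀ i v, P i v → ∃ j ≤ i, τ j ≤ v := by
  obtain ⟨τ, hτ, hmin⟩ := Set.exists_min_image {τ : Equiv.Perm (Fin n) | ∀ i, P i (τ i)}
    (fun τ => toLex (τ : Fin n → Fin n)) (Set.toFinite _) ⟨Fin.revPerm, hrev⟩
  simp only [Set.mem_ofPred_eq] at hτ hmin
  -- no inversion of `τ` can be undone without leaving the set
  have hswap : ∀ a b, a < b → τ b < τ a → ¬ P a (τ b) := by
    intro a b hab hlt hPa
    refine not_lt.2 (hmin ((Equiv.swap a b).trans τ) fun i => ?_)
      (Pi.lex_desc (f := τ) hab.le hlt)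
    rw [Equiv.trans_apply]
    rcases eq_or_ne i a with rfl | hia
    · rwa [Equiv.swap_apply_left]
    rcases eq_or_ne i b with rfl | hib
    · rw [Equiv.swap_apply_right]
      exact hP _ _ _ _ (hτ i) le_rfl hlt.le
    · rw [Equiv.swap_apply_of_ne_of_ne hia hib]
      exact hτ i
  refine ⟨τ, ?_, hτ, ?_⟩
  · rw [avoids_pattern132_iff]
    intro i j k hij hjk h1 h2
    exact hswap j k hjk h2 (hP _ _ _ _ (hτ i) hij.le h1.le)
  · intro i v hv
    by_contra! hc
    have hk : i < τ⁻¹ v := by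
      by_contra! hle
      simpa using hc _ hle
    exact hswap i (τ⁻¹ v) hk (by simpa using hc i le_rfl) (by simpa using hv)

/-- Every pair of ballot paths with the same final height comes from a 132-avoiding permutation. -/
lemma exists_avoids_132_of_paths {x y : ℕ → ℕ} (hx : Monotone x) (hy : Monotone y)
    (hx1 : ∀ t u, t ≤ u → u ≤ n → x u ≤ x t + (u - t))
    (hy1 : ∀ t u, t ≤ u → u ≤ n → y u ≤ y t + (u - t))
    (hx2 : ∀ t ≤ n, 2 * x t ≤ t) (hy2 : ∀ t ≤ n, 2 * y t ≤ t) (hxy : x n = y n) :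
    ∃ τ : Equiv.Perm (Fin n), Avoids τ pattern132 ∧
      ∀ t ≤ n, downCount τ t = x t ∧ downCount τ⁻¹ t = y t := by
  obtain ⟨τ, hav, hτ, hmin⟩ := exists_avoids_132_of_lower_bound
    (fun i v : Fin n => ∀ t ≤ n, (i.val < x t → x t + (n - t) ≤ v.val) ∧
      (i.val < y t + (n - t) → y t ≤ v.val))
    (fun i j v w h hij hvw t ht => by
      have := h t ht
      rw [Fin.le_def] at hij hvw
      omega)
    (fun i t ht => by
      have := hx2 t ht
      have := hy2 t ht
      rw [Fin.val_rev]
      omega)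
  refine ⟨τ, hav, fun t ht => ⟨le_antisymm ?_ ?_, le_antisymm ?_ ?_⟩⟩
  · by_contra! hc
    obtain ⟨hn, hfit⟩ := le_shiftedRank_iff.1 (Nat.succ_le_of_lt hc)
    have h0 := hfit ⟨0, by omega⟩ (by simp)
    have h0' := (τ ⟨0, by omega⟩).2
    obtain ⟨j, hj, hjv⟩ := hmin ⟨x t, by omega⟩ ⟨x t + (n - t), by omega⟩ fun u hu => by
      have := hy hu
      have := hx1 t n ht le_rfl
      rcases le_total t u with h | h
      · have := hx1 t u h hu
        simp only
        omega
      · have := hx h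
        simp only
        omega
    have := hfit j (Nat.lt_succ_of_le hj)
    rw [Fin.le_def] at hjv
    simp only at hjv
    omega
  · have := hx2 t ht
    exact le_shiftedRank_iff.2 ⟨by omega, fun i hi => (hτ i t ht).1 hi⟩
  · by_contra! hc
    obtain ⟨hn, hfit⟩ := le_shiftedRank_iff.1 (Nat.succ_le_of_lt hc)
    have h0 := hfit ⟨0, by omega⟩ (by simp)
    have h0' := (τ⁻¹ ⟨0, by omega⟩).2
    obtain ⟨j, hj, hjv⟩ := hmin ⟨y t + (n - t), by omega⟩ ⟨y t, by omega⟩ fun u hu => by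
      have := hx hu
      have := hy1 t n ht le_rfl
      rcases le_total t u with h | h
      · have := hy1 t u h hu
        simp only
        omega
      · have := hy h
        simp only
        omega
    have := hfit (τ j) (Nat.lt_succ_of_le hjv)
    rw [Fin.le_def] at hj
    simp only [perm_inv_apply] at hj this
    omega
  · have := hy2 t ht
    refine le_shiftedRank_iff.2 ⟨by omega, fun v hv => ?_⟩
    by_contra! hc
    have := (hτ (τ⁻¹ v) t ht).2 hc
    simp only [perm_apply_inv] at this
    omega

/-! ### There are at most as many 132-avoiding as 321-avoiding permutations -/

/-- `σ` and `τ` have the same running minima. -/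
def SameRunMin (σ τ : Equiv.Perm (Fin n)) : Prop :=
  ∀ i v, (∃ j ≤ i, τ j ≤ v) ↔ ∃ j ≤ i, σ j ≤ v

/-- A 132-avoiding permutation is determined by its running minima. -/
lemma Avoids.eq_of_sameRunMin {σ τ : Equiv.Perm (Fin n)} (hσ : Avoids σ pattern132)
    (hτ : Avoids τ pattern132) (h : SameRunMin σ τ) : σ = τ := by
  have key : ∀ σ τ : Equiv.Perm (Fin n), Avoids τ pattern132 → SameRunMin σ τ → ∀ i,
      (∀ j < i, σ j = τ j) → ¬ σ i < τ i := by
    intro σ τ hτ h i hj hlt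
    rw [avoids_pattern132_iff] at hτ
    have hik : i < τ⁻¹ (σ i) := by
      by_contra! hle
      rcases eq_or_lt_of_le hle with he | hl
      · have := perm_apply_inv τ (σ i)
        rw [he] at this
        exact hlt.ne this.symm
      · have := hj _ hl
        simp only [perm_apply_inv] at this
        exact hl.ne (σ.injective this)
    obtain ⟨j, hji, hjv⟩ := (h i (σ i)).2 ⟨i, le_rfl, le_rfl⟩
    have hne : j ≠ i := fun e => by rw [e] at hjv; exact not_le.2 hlt hjv
    have hji' := lt_of_le_of_ne hji hne
    have hjv' : τ j < σ i := lt_of_le_of_ne hjv fun e => by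
      rw [← hj j hji'] at e
      exact hne (σ.injective e)
    exact hτ j i (τ⁻¹ (σ i)) hji' hik (by simpa using hjv') (by simpa using hlt)
  ext1 i
  induction i using WellFoundedLT.induction with
  | ind i ih =>
    have h1 := key σ τ hτ h i ih
    have h2 := key τ σ hσ (fun i v => (h i v).symm) i fun j hj => (ih j hj).symm
    exact le_antisymm (not_lt.1 h2) (not_lt.1 h1)

/-- The lexicographically largest permutation with given running minima avoids 123, so its reverse
avoids 321. -/
lemma exists_avoids_321_sameRunMin (σ : Equiv.Perm (Fin n)) :
    ∃ ρ : Equiv.Perm (Fin n), Avoids ρ pattern321 ∧ SameRunMin σ (Fin.revPerm.trans ρ) := by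
  obtain ⟨τ, hτ, hmax⟩ := Set.exists_max_image {τ | SameRunMin σ τ}
    (fun τ => toLex (τ : Fin n → Fin n)) (Set.toFinite _) ⟨σ, fun _ _ => Iff.rfl⟩
  simp only [Set.mem_ofPred_eq] at hτ hmax
  have h123 : ∀ i j k, i < j → j < k → τ i < τ j → ¬ τ j < τ k := by
    intro i j k hij hjk h1 h2
    set τ' := (Equiv.swap j k).trans τ
    have hj' : τ' j = τ k := by simp [τ']
    have hk' : τ' k = τ j := by simp [τ']
    have ho : ∀ a, a ≠ j → a ≠ k → τ' a = τ a := fun a haj hak => by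
      simp [τ', Equiv.swap_apply_of_ne_of_ne haj hak]
    have hlex : toLex (τ : Fin n → Fin n) < toLex (τ' : Fin n → Fin n) := by
      have h3 := Pi.lex_desc (f := τ') hjk.le (by rw [hj', hk']; exact h2)
      have h4 : (τ' : Fin n → Fin n) ∘ Equiv.swap j k = τ := by
        funext a
        simp [τ']
      rwa [h4] at h3
    refine not_lt.2 (hmax τ' fun l v => ?_) hlex
    rw [← hτ l v]
    have hi' : τ' i = τ i := ho i hij.ne (hij.trans hjk).ne
    -- the entry at `i` is smaller than both of the exchanged entries, and precedes them
    constructor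
    · rintro ⟨a, hal, hav⟩
      by_cases haj : a = j
      · subst haj
        exact ⟨i, hij.le.trans hal, (h1.trans h2).le.trans (hj' ▸ hav)⟩
      by_cases hak : a = k
      · subst hak
        exact ⟨i, (hij.trans hjk).le.trans hal, h1.le.trans (hk' ▸ hav)⟩
      · exact ⟨a, hal, ho a haj hak ▸ hav⟩
    · rintro ⟨a, hal, hav⟩
      by_cases haj : a = j
      · subst haj
        exact ⟨i, hij.le.trans hal, hi'.trans_le (h1.le.trans hav)⟩
      by_cases hak : a = k
      · subst hak
        exact ⟨i, (hij.trans hjk).le.trans hal, hi'.trans_le ((h1.trans h2).le.trans hav)⟩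
      · exact ⟨a, hal, (ho a haj hak).trans_le hav⟩
  refine ⟨Fin.revPerm.trans τ, ?_, ?_⟩
  · rw [avoids_pattern321_iff]
    intro i j k hij hjk h1 h2
    exact h123 _ _ _ (Fin.rev_lt_rev.2 hjk) (Fin.rev_lt_rev.2 hij) h2 h1
  · convert hτ using 1
    ext a
    simp

lemma ncard_avoids_132_le (n : ℕ) :
    {σ : Equiv.Perm (Fin n) | Avoids σ pattern132}.ncard ≤
      {σ : Equiv.Perm (Fin n) | Avoids σ pattern321}.ncard := by
  choose f hf1 hf2 using exists_avoids_321_sameRunMin (n := n)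
  refine Set.ncard_le_ncard_of_injOn f (fun σ _ => hf1 σ) ?_ (Set.toFinite _)
  intro σ hσ τ hτ he
  refine Avoids.eq_of_sameRunMin hσ hτ fun i v => ?_
  rw [← hf2 σ i v, ← hf2 τ i v, he]

/-! ### The statistics-preserving bijection -/

lemma lisDefect_le_add (σ : Equiv.Perm (Fin n)) {t u : ℕ} (h : t ≤ u) :
    lisDefect σ u ≤ lisDefect σ t + (u - t) := by
  have := prefixLis_mono σ h
  have := prefixLis_le σ t
  unfold lisDefect
  omega

lemma lisDefect_mono (σ : Equiv.Perm (Fin n)) : Monotone (lisDefect σ) := by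
  refine monotone_nat_of_le_succ fun t => ?_
  have := prefixLis_succ_le σ t
  have := prefixLis_le σ t
  unfold lisDefect
  omega

/-- The 132-avoiding permutation with the same pair of paths as a given 321-avoiding one. -/
lemma Avoids.exists_avoids_132 {σ : Equiv.Perm (Fin n)} (h : Avoids σ pattern321) :
    ∃ τ : Equiv.Perm (Fin n), Avoids τ pattern132 ∧
      ∀ t ≤ n, downCount τ t = lisDefect σ t ∧ downCount τ⁻¹ t = lisDefect σ⁻¹ t := by
  refine exists_avoids_132_of_paths (lisDefect_mono σ) (lisDefect_mono σ⁻¹)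
    (fun t u htu _ => lisDefect_le_add σ htu) (fun t u htu _ => lisDefect_le_add σ⁻¹ htu)
    (fun t ht => ?_) (fun t ht => ?_) ?_
  · have := h.le_two_mul_prefixLis ht
    unfold lisDefect
    omega
  · have := h.inv_321.le_two_mul_prefixLis ht
    unfold lisDefect
    omega
  · rw [lisDefect, lisDefect, prefixLis_self, prefixLis_inv_self]

lemma stats_eq_of_paths_eq {σ τ : Equiv.Perm (Fin n)} (hσ : Avoids σ pattern321)
    (hτ : Avoids τ pattern132)
    (h : ∀ t ≤ n, downCount τ t = lisDefect σ t ∧ downCount τ⁻¹ t = lisDefect σ⁻¹ t) :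
    fp τ = fp σ ∧ exc τ = exc σ ∧ rank τ + lis σ = n := by
  classical
  have hmin : ∀ t < n, IsFutureMin (downCount τ) (downCount τ⁻¹) n t ↔
      IsFutureMin (lisDefect σ) (lisDefect σ⁻¹) n t := fun t ht =>
    IsFutureMin.congr (fun s hs => (h s hs).1) (fun s hs => (h s hs).2) ht.le
  have hrank : rank τ + lis σ = n := by
    have h1 := (h n le_rfl).1
    rw [downCount_self, lisDefect, prefixLis_self] at h1
    have h2 := prefixLis_le σ n
    rw [prefixLis_self] at h2
    omega
  refine ⟨?_, ?_, hrank⟩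
  · rw [hτ.fp_eq_numTies_downCount, hσ.fp_eq_numTies]
    unfold numTies
    congr 1
    refine filter_congr fun t ht => ?_
    rw [mem_range] at ht
    rw [hmin t ht, (h t ht.le).1, (h t ht.le).2]
  · have h1 : numSecondLower (downCount τ) (downCount τ⁻¹) n =
        numSecondLower (lisDefect σ) (lisDefect σ⁻¹) n := by
      unfold numSecondLower
      congr 1
      refine filter_congr fun t ht => ?_
      rw [mem_range] at ht
      rw [hmin t ht, (h t ht.le).1, (h t ht.le).2]
    have h2 := hτ.exc_eq_rank_add
    have h3 := hσ.exc_add_lis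
    omega

/-- The 132-avoiding permutations with the same pairs of paths as the 321-avoiding ones are all the
132-avoiding permutations, because there are not more of them than 321-avoiding ones. -/
lemma exists_bijOn (n : ℕ) : ∃ f : Equiv.Perm (Fin n) → Equiv.Perm (Fin n),
    Set.BijOn f {σ | Avoids σ pattern321} {σ | Avoids σ pattern132} ∧
      ∀ σ, Avoids σ pattern321 →
        fp (f σ) = fp σ ∧ exc (f σ) = exc σ ∧ rank (f σ) + lis σ = n := by
  have hex := fun (σ : Equiv.Perm (Fin n)) (h : Avoids σ pattern321) => h.exists_avoids_132
  choose! f hf1 hf2 using hex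
  refine ⟨f, ?_, fun σ hσ => stats_eq_of_paths_eq hσ (hf1 σ hσ) (hf2 σ hσ)⟩
  have hinj : Set.InjOn f {σ | Avoids σ pattern321} := by
    intro σ hσ τ hτ he
    have hlen : ∀ t ≤ n, prefixLis σ t = prefixLis τ t ∧ prefixLis σ⁻¹ t = prefixLis τ⁻¹ t := by
      intro t ht
      have h1 := hf2 σ hσ t ht
      have h2 := hf2 τ hτ t ht
      rw [he] at h1
      have := prefixLis_le σ t
      have := prefixLis_le τ t
      have := prefixLis_le σ⁻¹ t
      have := prefixLis_le τ⁻¹ t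
      unfold lisDefect at h1 h2
      omega
    exact hσ.eq_of_prefixLis_eq hτ (fun t ht => (hlen t ht).1) fun t ht => (hlen t ht).2
  refine ⟨fun σ hσ => hf1 σ hσ, hinj, ?_⟩
  have himg : f '' {σ | Avoids σ pattern321} ⊆ {σ | Avoids σ pattern132} := by
    rintro _ ⟨σ, hσ, rfl⟩
    exact hf1 σ hσ
  refine (Set.eq_of_subset_of_ncard_le himg ?_).ge
  rw [hinj.ncard_image]
  exact ncard_avoids_132_le n

end PatternAvoidance

theorem theorem2 (n i j k : ℕ) :
    Set.ncard {σ : Equiv.Perm (Fin n) |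
        PatternAvoidance.Avoids σ PatternAvoidance.pattern321 ∧
          PatternAvoidance.fp σ = i ∧ PatternAvoidance.exc σ = j ∧ PatternAvoidance.lis σ = k} =
      Set.ncard {σ : Equiv.Perm (Fin n) |
        PatternAvoidance.Avoids σ PatternAvoidance.pattern132 ∧
          PatternAvoidance.fp σ = i ∧ PatternAvoidance.exc σ = j ∧
            (PatternAvoidance.rank σ : ℤ) = (n : ℤ) - (k : ℤ)} := by
  obtain ⟨f, hf, hstat⟩ := PatternAvoidance.exists_bijOn n
  rw [← (hf.injOn.mono fun σ hσ => hσ.1).ncard_image]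
  congr 1
  ext τ
  constructor
  · rintro ⟨σ, ⟨hσ, h1, h2, h3⟩, rfl⟩
    have h4 := hstat σ hσ
    exact ⟨hf.mapsTo hσ, by omega, by omega, by omega⟩
  · rintro ⟨hτ, h1, h2, h3⟩
    obtain ⟨σ, hσ, rfl⟩ := hf.surjOn hτ
    have h4 := hstat σ hσ
    exact ⟨σ, ⟨hσ, by omega, by omega, by omega⟩, rfl⟩
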